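/- Let $T>0$ and let $\sigma$ be a continuous positive probability density on $(0,T)$ (seasonality). For $n$ items with costs $c\in\mathbb R^n$, $c_i\ge 0$, and a demand model $S=S(I,p)\in\mathbb R^n$ consider the problem of maximizing $$\int_0^T\bigl[-\langle c,\rho^2\rangle+\langle p,S(I,p)\rangle\bigr]\sigma\,dt\quad\text{subject to}\quad \frac{dI}{dt}=-S(I,p)\,\sigma+\rho^2\sigma,\quad I(0)=I_0,\ I(T)=I_T ,$$ over all policies consisting of an inventory $I$, continuous on $[0,T]$ and differentiable on $(0,T)$, a price $p$ and a replenishment function $\rho$, both continuous on $(0,T)$, with $I_i(t)>0$, $p_i(t)>0$, $\rho_i(t)\ge 0$ for $0<t<T$ and all $i$ (here $\rho^2$ is taken componentwise), and integrable objective. Two cases are considered: (CR) an optimal policy of this problem with $\rho_i(t)\neq 0$ for all $i$ and all $t\in(0,T)$; (MD) a policy that is optimal for the same problem with $\rho\equiv 0$ imposed (markdown; for instance with $I_T=0$). The de-seasoned sales and revenue rates of a policy are $S(t)=S(I(t),p(t))$ and $R_i(t)=p_i(t)S_i(t)$. In both cases (CR) and (MD) the following hold. (i) For the exponential model $\log S=\log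 S_0+\alpha\log I+\Gamma p$, with a constant vector $S_0$ with positive entries and constant $n\times n$ matrices $\alpha$ and $\Gamma$, $\Gamma$ invertible, the quantity $\langle S(t),\Gamma^{-1}1_n\rangle$ is constant on $(0,T)$ along every optimal policy, where $1_n=(1,\dots,1)$. (ii) For the one-dimensional exponential model $S=S_0I^{\alpha}e^{\gamma p}$, with constants $S_0>0$ and $\alpha,\gamma\in\mathbb R$, the sales rate $S(t)$ is constant on $(0,T)$ along every optimal policy. (iii) For the one-dimensional constant-elasticity model $S=S_0I^{\alpha}p^{\gamma}$, with constants $S_0>0$ and $\alpha,\gamma\in\mathbb R$, the revenue rate $R(t)=p(t)S(t)$ is constant on $(0,T)$ along every optimal policy. -/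

import Mathlib

open Set MeasureTheory
open scoped Matrix

/-- A demand model for `n` items: inventory vector and price vector to the vector of
(de-seasoned) rates of sales. -/
abbrev Demand (n : ℕ) : Type := (Fin n → ℝ) → (Fin n → ℝ) → Fin n → ℝ

/-- The data of a retail pricing problem on `[0, T]`: seasonality `σ`, unit costs `c`, demand
model `S`, initial and final inventories. -/
structure RetailProblem (n : ℕ) where
  T : ℝ
  σ : ℝ → ℝ
  c : Fin n → ℝ
  S : Demand n
  I₀ : Fin n → ℝ
  I₁ : Fin n → ℝ

/-- A price / inventory policy: inventory `I`, price `p`, and `ρ`, whose square is the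
de-seasoned replenishment rate. -/
structure Policy (n : ℕ) where
  I : ℝ → Fin n → ℝ
  p : ℝ → Fin n → ℝ
  ρ : ℝ → Fin n → ℝ

/-- A seasonality on `[0, T]`: a continuous positive probability density. -/
structure IsSeasonality (T : ℝ) (σ : ℝ → ℝ) : Prop where
  continuousOn : ContinuousOn σ (Ioo 0 T)
  pos : ∀ t ∈ Ioo 0 T, 0 < σ t
  integral_eq_one : ∫ t in (0 : ℝ)..T, σ t = 1

namespace RetailProblem

variable {n : ℕ}

/-- De-seasoned rate of sales at time `t`, `S(I(t), p(t))`. -/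
def sales (P : RetailProblem n) (x : Policy n) (t : ℝ) : Fin n → ℝ :=
  P.S (x.I t) (x.p t)

/-- De-seasoned revenue rate at time `t`, the componentwise product `p S`. -/
def revenue (P : RetailProblem n) (x : Policy n) (t : ℝ) : Fin n → ℝ :=
  fun i => x.p t i * P.sales x t i

/-- The integrand `(-⟨c, ρ²⟩ + ⟨p, S(I, p)⟩) σ` of the objective. -/
noncomputable def profitRate (P : RetailProblem n) (x : Policy n) (t : ℝ) : ℝ :=
  (-(∑ i, P.c i * x.ρ t i ^ 2) + ∑ i, x.p t i * P.sales x t i) * P.σ t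

/-- The objective, `∫₀ᵀ (-⟨c, ρ²⟩ + ⟨p, S(I, p)⟩) σ dt`. -/
noncomputable def profit (P : RetailProblem n) (x : Policy n) : ℝ :=
  ∫ t in (0 : ℝ)..P.T, P.profitRate x t

/-- Admissible policies: continuous controls, positive prices and inventories on `(0, T)`, the
inventory flow equation `dI/dt = -S(I, p) σ + ρ² σ`, the boundary constraints, and a well-defined
(finite) objective. Prices and replenishment need not extend to the end points, since inventory
may vanish there. -/
structure Admissible (P : RetailProblem n) (x : Policy n) : Prop where
  continuousOn_I : ContinuousOn x.I (Icc 0 P.T)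
  continuousOn_p : ContinuousOn x.p (Ioo 0 P.T)
  continuousOn_ρ : ContinuousOn x.ρ (Ioo 0 P.T)
  I_pos : ∀ t ∈ Ioo 0 P.T, ∀ i, 0 < x.I t i
  p_pos : ∀ t ∈ Ioo 0 P.T, ∀ i, 0 < x.p t i
  ρ_nonneg : ∀ t ∈ Ioo 0 P.T, ∀ i, 0 ≤ x.ρ t i
  flow : ∀ t ∈ Ioo 0 P.T,
    HasDerivAt x.I (fun i => -(P.sales x t i * P.σ t) + x.ρ t i ^ 2 * P.σ t) t
  initial : x.I 0 = P.I₀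
  final : x.I P.T = P.I₁
  integrable : IntervalIntegrable (P.profitRate x) volume 0 P.T

/-- `x` maximizes the objective among all admissible policies. -/
def IsOptimal (P : RetailProblem n) (x : Policy n) : Prop :=
  P.Admissible x ∧ ∀ y, P.Admissible y → P.profit y ≤ P.profit x

/-- No item is replenished. -/
def NoReplenishment (P : RetailProblem n) (x : Policy n) : Prop :=
  ∀ t ∈ Ioo 0 P.T, ∀ i, x.ρ t i = 0

/-- Optimal continuous replenishment (CR): an optimal policy that replenishes every item at all
times. -/
def IsOptimalCR (P : RetailProblem n) (x : Policy n) : Prop :=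
  P.IsOptimal x ∧ ∀ t ∈ Ioo 0 P.T, ∀ i, x.ρ t i ≠ 0

/-- Optimal markdown (MD): the policy is optimal for the problem with `ρ ≡ 0`. In particular
every optimal policy (in the sense of `IsOptimal`) without replenishment is of this kind. -/
def IsOptimalMD (P : RetailProblem n) (x : Policy n) : Prop :=
  (P.Admissible x ∧ P.NoReplenishment x) ∧
    ∀ y, P.Admissible y → P.NoReplenishment y → P.profit y ≤ P.profit x

end RetailProblem

/-- The exponential model `log S = log S₀ + α log I + Γ p`. -/
noncomputable def exponentialDemand {n : ℕ} (S₀ : Fin n → ℝ) (α Γ : Matrix (Fin n) (Fin n) ℝ) :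
    Demand n :=
  fun I p i => Real.exp (Real.log (S₀ i) + (α *ᵥ fun j => Real.log (I j)) i + (Γ *ᵥ p) i)

/-- The one-item exponential model `S = S₀ I ^ α e ^ (p γ)`. -/
noncomputable def exponentialDemandOne (S₀ α γ : ℝ) : Demand 1 :=
  fun I p _ => S₀ * I 0 ^ α * Real.exp (p 0 * γ)

/-- The one-item constant elasticity model `S = S₀ I ^ α p ^ γ`. -/
noncomputable def constantElasticityDemandOne (S₀ α γ : ℝ) : Demand 1 :=
  fun I p _ => S₀ * I 0 ^ α * p 0 ^ γ

/-!
The three constants of motion come from one symmetry. In the de-seasoned time `∫ σ dt` the problem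
is autonomous, so a policy may be run through at a different speed: given a change of time `φ` of
`[0, T]`, follow the inventory curve `I ∘ φ`. Sales and replenishment rates must then be
multiplied by a speed `e ^ u`, and in each model a suitable change of price, `p ↦ q u p`,
multiplies the sales by exactly this factor: `p + u Γ⁻¹ 1` in the exponential model, `p + u / γ`
for one item, `p e ^ (u / γ)` for constant elasticity. The only effect on the objective is the one
of the changed prices, which is `∫ G (u) f σ` after substitution, where `f` is `⟨S, Γ⁻¹ 1⟩`, `S` or
`R`, and `G (u)` is `u`, `u / γ` or `e ^ (u / γ) - 1`
(`RetailProblem.Admissible.exists_reparametrization`).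

Take `e ^ (-u) = 1 + ε h`, where `h` is supported in `(a, b)` with `0 < a < b < T`. The constraint
that `φ` fixes the end points is `∫ h σ = 0`, and prices stay positive for small `ε` because the
change is confined to a compact subset of `(0, T)`. Optimality makes the first variation
`-G'(0) ∫ h f σ` vanish. For `h = w (f - m)`, with a bump `w` and the weighted mean `m` of `f`, this
says that a weighted variance of `f` is zero (`exists_eq_const_of_variation`), so `f` is constant.

The new policy replenishes only if the old one does, so (CR) and (MD) are treated alike. As
inventory is only precomposed with a diffeomorphism of class `C¹`, no second derivatives
(Euler-Lagrange equations, regularity of the optimum) are needed. If `γ = 0`, the price is without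
influence on sales and there is no optimal policy
(`RetailProblem.not_isOptimal_of_sales_indep`).
-/

open Filter Topology

/-! ### Changes of time -/

/-- A change of time `φ` that transforms the density `θ` into `σ`, that is, `θ (φ t) φ' (t) = σ t`,
and is the identity outside `(a, b)`. It is `L⁻¹ ∘ H` with `L`, `H` the primitives of `θ`, `σ`. -/
theorem exists_timeChange {a b : ℝ} (hab : a < b) {σ θ : ℝ → ℝ} (hσ : Continuous σ)
    (hθ : Continuous θ) (hσ₀ : ∀ t, 0 < σ t) (hθ₀ : ∀ t, 0 < θ t)
    (heq : ∀ t, t ∉ Ioo a b → θ t = σ t) (hint : ∫ t in a..b, θ t = ∫ t in a..b, σ t) :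
    ∃ φ : ℝ → ℝ, StrictMono φ ∧ Continuous φ ∧ (∀ t, t ∉ Ioo a b → φ t = t) ∧
      ∀ t, HasDerivAt φ (σ t / θ (φ t)) t := by
  have primitive : ∀ κ : ℝ → ℝ, Continuous κ → (∀ t, 0 < κ t) →
      (∀ t, HasDerivAt (fun t => ∫ s in a..t, κ s) (κ t) t) ∧
        StrictMono (fun t => ∫ s in a..t, κ s) := by
    intro κ hκ hκ₀
    have h1 : ∀ t, HasDerivAt (fun t => ∫ s in a..t, κ s) (κ t) t := fun t =>
      intervalIntegral.integral_hasDerivAt_right (hκ.intervalIntegrable _ _)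
        (hκ.stronglyMeasurableAtFilter _ _) hκ.continuousAt
    exact ⟨h1, strictMono_of_hasDerivAt_pos h1 hκ₀⟩
  obtain ⟨hH, hHm⟩ := primitive σ hσ hσ₀
  obtain ⟨hL, hLm⟩ := primitive θ hθ hθ₀
  set H : ℝ → ℝ := fun t => ∫ s in a..t, σ s with hHdef
  set L : ℝ → ℝ := fun t => ∫ s in a..t, θ s with hLdef
  have hHc : Continuous H := continuous_iff_continuousAt.2 fun t => (hH t).continuousAt
  have hLc : Continuous L := continuous_iff_continuousAt.2 fun t => (hL t).continuousAt
  have hout : ∀ t, t ∉ Ioo a b → L t = H t := by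
    intro t ht
    rcases le_or_gt t a with hta | hta
    · refine intervalIntegral.integral_congr fun s hs => heq s fun h => ?_
      rw [uIcc_of_ge hta] at hs
      exact absurd h.1 (not_lt.2 hs.2)
    · have htb : b ≤ t := not_lt.1 fun h => ht ⟨hta, h⟩
      simp only [hHdef, hLdef]
      rw [← intervalIntegral.integral_add_adjacent_intervals (hθ.intervalIntegrable a b)
          (hθ.intervalIntegrable b t), ← intervalIntegral.integral_add_adjacent_intervals
          (hσ.intervalIntegrable a b) (hσ.intervalIntegrable b t), hint]
      congr 1
      refine intervalIntegral.integral_congr fun s hs => heq s fun h => ?_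
      rw [uIcc_of_le htb] at hs
      exact absurd h.2 (not_lt.2 hs.1)
  have ha : L a = H a := hout a fun h => lt_irrefl _ h.1
  have hb : L b = H b := hout b fun h => lt_irrefl _ h.2
  -- used for `L`, `H` (existence of `φ`) and for `H`, `L` (surjectivity of `φ`)
  have ivt : ∀ A B : ℝ → ℝ, Continuous A → StrictMono B → A a = B a → A b = B b →
      (∀ t, t ∉ Ioo a b → A t = B t) → ∀ t, ∃ s, A s = B t := by
    intro A B hA hB h1 h2 h3 t
    by_cases ht : t ∈ Ioo a b
    · obtain ⟨s, -, hs⟩ := intermediate_value_Icc hab.le hA.continuousOn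
        (show B t ∈ Icc (A a) (A b) by
          rw [h1, h2]; exact ⟨(hB ht.1).le, (hB ht.2).le⟩)
      exact ⟨s, hs⟩
    · exact ⟨t, h3 t ht⟩
  choose φ hφ using ivt L H hLc hHm ha hb hout
  have hφm : StrictMono φ := fun s t hst => hLm.lt_iff_lt.1 (by rw [hφ, hφ]; exact hHm hst)
  have hφs : Function.Surjective φ := fun s => by
    obtain ⟨t, ht⟩ := ivt H L hHc hLm ha.symm hb.symm (fun t ht => (hout t ht).symm) s
    exact ⟨t, hLm.injective (by rw [hφ, ht])⟩
  have hφc : Continuous φ := hφm.monotone.continuous_of_surjective hφs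
  exact ⟨φ, hφm, hφc, fun t ht => hLm.injective (by rw [hφ, hout t ht]), fun t =>
    HasDerivAt.of_comp_left hφc.continuousAt (hL _) (hH t) (hθ₀ _).ne' (.of_forall hφ)⟩

/-! ### First variation -/

/-- Differentiation under the integral sign at a single point, by dominated convergence of the
difference quotients; `g` need not be differentiable, or even continuous, away from `0`. -/
theorem hasDerivAt_integral_comp_mul {a b : ℝ} {g h k : ℝ → ℝ} {g' : ℝ} (hg : HasDerivAt g g' 0)
    (hg₀ : g 0 = 0) (hgm : Measurable g) (hh : Continuous h) (hk : ContinuousOn k (uIcc a b)) :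
    HasDerivAt (fun ε => ∫ s in a..b, g (ε * h s) * k s) (g' * ∫ s in a..b, h s * k s) 0 := by
  rw [hasDerivAt_iff_tendsto_slope_zero]
  simp only [zero_add, zero_mul, hg₀, intervalIntegral.integral_zero, sub_zero, smul_eq_mul,
    ← intervalIntegral.integral_const_mul]
  obtain ⟨C, hC⟩ := hg.isBigO_sub.bound
  obtain ⟨M, hM⟩ := isCompact_uIcc.exists_bound_of_continuousOn (hh.continuousOn (s := uIcc a b))
  have hki := hk.intervalIntegrable (μ := volume)
  have hMp : 0 < |M| + 1 := by positivity
  refine intervalIntegral.tendsto_integral_filter_of_dominated_convergence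
    (fun s => |C| * (|M| + 1) * |k s|) (Eventually.of_forall fun ε => ?_) ?_
    (hki.abs.const_mul _) (ae_of_all _ fun s _ => ?_)
  · refine (Measurable.aestronglyMeasurable ?_).mul ?_ |>.const_mul _
    · exact hgm.comp (measurable_const.mul hh.measurable)
    · exact hki.aestronglyMeasurable_restrict_uIoc
  · rw [Metric.eventually_nhds_iff] at hC
    obtain ⟨δ, hδ, hC⟩ := hC
    have h1 : ∀ᶠ ε : ℝ in 𝓝[≠] 0, |ε| < δ / (|M| + 1) :=
      nhdsWithin_le_nhds (by
        have := Metric.ball_mem_nhds (0 : ℝ) (div_pos hδ hMp)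
        filter_upwards [this] with ε hε
        simpa using hε)
    filter_upwards [h1, self_mem_nhdsWithin] with ε hε hε0
    refine ae_of_all _ fun s hs => ?_
    have hhs : |h s| ≤ |M| + 1 :=
      (hM s (uIoc_subset_uIcc hs)).trans ((le_abs_self M).trans (by linarith))
    have h2 : |ε * h s| < δ := by
      rw [abs_mul]
      calc |ε| * |h s| ≤ |ε| * (|M| + 1) := by gcongr
        _ < δ := (lt_div_iff₀ hMp).1 hε
    have h3 := hC (y := ε * h s) (by simpa using h2)
    simp only [hg₀, sub_zero, Real.norm_eq_abs] at h3
    have hε' : 0 < |ε| := abs_pos.2 hε0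
    rw [Real.norm_eq_abs, abs_mul, abs_mul, abs_inv, ← mul_assoc]
    refine mul_le_mul_of_nonneg_right ?_ (abs_nonneg _)
    rw [inv_mul_le_iff₀ hε']
    calc |g (ε * h s)| ≤ C * |ε * h s| := h3
      _ ≤ |C| * (|ε| * (|M| + 1)) := by
        rw [abs_mul]; gcongr; exact le_abs_self C
      _ = _ := by ring
  · have h1 : HasDerivAt (fun ε => g (ε * h s)) (g' * h s) 0 := by
      have h2 : HasDerivAt (fun ε : ℝ => ε * h s) (h s) 0 := by
        simpa using (hasDerivAt_id (0 : ℝ)).mul_const (h s)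
      exact HasDerivAt.comp (h₂ := g) 0 (by simpa using hg) h2
    have h3 := (hasDerivAt_iff_tendsto_slope_zero.1 h1).mul_const (k s)
    simpa [hg₀, mul_assoc] using h3

/-- A du Bois-Reymond lemma for one-sided variations: `ε = 0` is a maximum of the integral, so its
derivative `-d ∫ h f σ` vanishes for all `h` with `∫ h σ = 0`. -/
theorem exists_eq_const_of_variation {a b : ℝ} (hab : a < b) {f σ G : ℝ → ℝ} {d : ℝ}
    (hf : ContinuousOn f (Icc a b)) (hσ : ContinuousOn σ (Icc a b))
    (hσ₀ : ∀ t ∈ Icc a b, 0 < σ t) (hG : HasDerivAt G d 0) (hd : d ≠ 0) (hG₀ : G 0 = 0)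
    (hGc : Continuous G)
    (H : ∀ h : ℝ → ℝ, Continuous h → (∀ t, t ∉ Ioo a b → h t = 0) →
      ∫ t in a..b, h t * σ t = 0 →
      ∀ᶠ ε in 𝓝 (0 : ℝ), ∫ t in a..b, G (-Real.log (1 + ε * h t)) * (f t * σ t) ≤ 0) :
    ∃ m, ∀ t ∈ Ioo a b, f t = m := by
  have hu : uIcc a b = Icc a b := uIcc_of_le hab.le
  set F : ℝ → ℝ := IccExtend hab.le ((Icc a b).domRestrict f) with hF
  have hFc : Continuous F := hf.domRestrict.Icc_extend'
  have hFf : ∀ t ∈ Icc a b, F t = f t := fun t ht => by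
    rw [hF, IccExtend_of_mem _ _ ht]; rfl
  let w : ℝ → ℝ := fun t => max 0 ((t - a) * (b - t))
  have hwc : Continuous w := by fun_prop
  have hw₀ : ∀ t, t ∉ Ioo a b → w t = 0 := fun t ht => by
    refine max_eq_left ?_
    by_contra! hlt
    rcases pos_and_pos_or_neg_and_neg_of_mul_pos hlt with h | h
    · exact ht ⟨by linarith, by linarith⟩
    · linarith
  have hwpos : ∀ t ∈ Ioo a b, 0 < w t := fun t ht =>
    lt_max_of_lt_right (mul_pos (sub_pos.2 ht.1) (sub_pos.2 ht.2))
  have hwi : IntervalIntegrable (fun t => w t * σ t) volume a b :=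
    (hwc.continuousOn.mul (hu ▸ hσ)).intervalIntegrable
  have hwFi : IntervalIntegrable (fun t => F t * (w t * σ t)) volume a b :=
    (hFc.continuousOn.mul (hwc.continuousOn.mul (hu ▸ hσ))).intervalIntegrable
  have hW : 0 < ∫ t in a..b, w t * σ t :=
    intervalIntegral.intervalIntegral_pos_of_pos_on hwi
      (fun t ht => mul_pos (hwpos t ht) (hσ₀ t (Ioo_subset_Icc_self ht))) hab
  -- the mean of `f` for the weight `w σ`; it makes `h σ` have integral zero
  set m : ℝ := (∫ t in a..b, F t * (w t * σ t)) / ∫ t in a..b, w t * σ t with hm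
  let h : ℝ → ℝ := fun t => w t * (F t - m)
  have hhc : Continuous h := by fun_prop
  have hh₀ : ∫ t in a..b, h t * σ t = 0 := by
    have : ∀ t, h t * σ t = F t * (w t * σ t) - m * (w t * σ t) := fun t => by
      simp only [h]; ring
    simp only [this]
    rw [intervalIntegral.integral_sub hwFi (hwi.const_mul _),
      intervalIntegral.integral_const_mul, hm, div_mul_cancel₀ _ hW.ne', sub_self]
  have hev := H h hhc (fun t ht => by simp [h, hw₀ t ht]) hh₀
  -- the first variation vanishes
  have hg : HasDerivAt (fun v : ℝ => G (-Real.log (1 + v))) (d * -1) 0 := by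
    have h1 : HasDerivAt (fun v : ℝ => -Real.log (1 + v)) (-1) 0 := by
      have := (((hasDerivAt_id' (0 : ℝ)).const_add 1).log (by simp)).fun_neg
      simpa using this
    exact HasDerivAt.comp (h₂ := G) 0 (by simpa using hG) h1
  have hder := hasDerivAt_integral_comp_mul (a := a) (b := b) (h := h)
    (k := fun t => f t * σ t) hg (by simp [hG₀])
    (hGc.measurable.comp (Real.measurable_log.comp (measurable_const.add measurable_id)).neg)
    hhc (hu ▸ hf.mul hσ)
  have hmax : IsLocalMax (fun ε => ∫ s in a..b, G (-Real.log (1 + ε * h s)) * (f s * σ s)) 0 := by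
    filter_upwards [hev] with ε hε
    simpa [hG₀] using hε
  have hz := hmax.hasDerivAt_eq_zero hder
  have hz' : ∫ s in a..b, h s * (f s * σ s) = 0 := by
    rcases mul_eq_zero.1 hz with h0 | h0
    · exact absurd (by linarith : d = 0) hd
    · exact h0
  -- hence the weighted variance of `f` vanishes
  have hvar : ∫ s in a..b, w s * (F s - m) ^ 2 * σ s = 0 := by
    have h1 : ∫ s in a..b, w s * (F s - m) ^ 2 * σ s =
        ∫ s in a..b, (h s * (f s * σ s) - m * (h s * σ s)) := by
      refine intervalIntegral.integral_congr fun s hs => ?_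
      simp only [h, ← hFf s (hu ▸ hs)]; ring
    rw [h1, intervalIntegral.integral_sub, intervalIntegral.integral_const_mul, hz', hh₀]
    · simp
    · exact (hhc.continuousOn.mul (hu ▸ hf.mul hσ)).intervalIntegrable
    · exact ((hhc.continuousOn.mul (hu ▸ hσ)).intervalIntegrable).const_mul _
  refine ⟨m, fun t ht => ?_⟩
  by_contra hne
  have hc : ContinuousOn (fun s => w s * (F s - m) ^ 2 * σ s) (Icc a b) :=
    (Continuous.continuousOn (by fun_prop)).mul hσ
  refine (intervalIntegral.integral_pos hab hc (fun s hs => ?_)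
    ⟨t, Ioo_subset_Icc_self ht, ?_⟩).ne' hvar
  · exact mul_nonneg (mul_nonneg (le_max_left _ _) (sq_nonneg _))
      (hσ₀ s (Ioc_subset_Icc_self hs)).le
  · have : F t - m ≠ 0 := by rw [hFf t (Ioo_subset_Icc_self ht)]; exact sub_ne_zero.2 hne
    exact mul_pos (mul_pos (hwpos t ht) (by positivity)) (hσ₀ t (Ioo_subset_Icc_self ht))

/-! ### Reparametrized policies -/

namespace RetailProblem

variable {n : ℕ}

/-- Running through the policy `x` at the relative speed `exp (v s)` when it is in the state of time
`s`, with prices `q` that let the sales keep pace. By `hrev` the gain of revenue, per unit of the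
de-seasoned time of `x`, is `G (v s) * f s`. The hypothesis `hint` says that the time saved in one
part of `[a, b]` is lost in another, so the new policy is the old one outside `[a, b]`. -/
theorem Admissible.exists_reparametrization {P : RetailProblem n} {x : Policy n}
    (hx : P.Admissible x) (hσ : ContinuousOn P.σ (Ioo 0 P.T)) (hσ₀ : ∀ t ∈ Ioo 0 P.T, 0 < P.σ t)
    {a b : ℝ} (ha : 0 < a) (hab : a < b) (hb : b < P.T) {v : ℝ → ℝ} (hv : Continuous v)
    (hv₀ : ∀ t, t ∉ Ioo a b → v t = 0)
    (hint : ∫ t in a..b, Real.exp (-v t) * P.σ t = ∫ t in a..b, P.σ t)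
    {q : ℝ → (Fin n → ℝ) → Fin n → ℝ} (hq : Continuous fun z : ℝ × (Fin n → ℝ) => q z.1 z.2)
    (hq₀ : ∀ p, q 0 p = p) (hpos : ∀ t ∈ Icc a b, ∀ i, 0 < q (v t) (x.p t) i)
    (hS : ∀ t ∈ Ioo 0 P.T, ∀ u, P.S (x.I t) (q u (x.p t)) = Real.exp u • P.sales x t)
    {G f : ℝ → ℝ} (hG : Continuous G) (hG₀ : G 0 = 0) (hf : ContinuousOn f (Ioo 0 P.T))
    (hrev : ∀ t ∈ Ioo 0 P.T, ∀ u, ∑ i, q u (x.p t) i * P.sales x t i =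
      ∑ i, x.p t i * P.sales x t i + G u * f t) :
    ∃ y, P.Admissible y ∧ (P.NoReplenishment x → P.NoReplenishment y) ∧
      P.profit y = P.profit x + ∫ t in a..b, G (v t) * (f t * P.σ t) := by
  have hT : 0 < P.T := ha.trans (hab.trans hb)
  have hsub : Icc a b ⊆ Ioo 0 P.T := fun t ht => ⟨ha.trans_le ht.1, ht.2.trans_lt hb⟩
  have hu : uIcc a b = Icc a b := uIcc_of_le hab.le
  -- extend `σ` from `[a, b]` to a continuous positive function on the line
  set τ : ℝ → ℝ := IccExtend hab.le ((Icc a b).domRestrict P.σ) with hτ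
  have hτc : Continuous τ := (hσ.mono hsub).domRestrict.Icc_extend'
  have hτσ : ∀ t ∈ Icc a b, τ t = P.σ t := fun t ht => by
    rw [hτ, IccExtend_of_mem _ _ ht]; rfl
  have hτ₀ : ∀ t, 0 < τ t := fun t => hσ₀ _ (hsub (projIcc a b hab.le t).2)
  obtain ⟨φ, hφm, hφc, hφo, hφd⟩ := exists_timeChange hab hτc
    (θ := fun t => Real.exp (-v t) * τ t) (by fun_prop) hτ₀
    (fun t => mul_pos (Real.exp_pos _) (hτ₀ t)) (fun t ht => by simp [hv₀ t ht]) (by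
      have h1 : ∫ t in a..b, Real.exp (-v t) * τ t = ∫ t in a..b, Real.exp (-v t) * P.σ t :=
        intervalIntegral.integral_congr fun t ht => by
          simp only [hτσ t (hu ▸ ht)]
      have h2 : ∫ t in a..b, τ t = ∫ t in a..b, P.σ t :=
        intervalIntegral.integral_congr fun t ht => hτσ t (hu ▸ ht)
      rw [h1, h2, hint])
  have hφ0 : φ 0 = 0 := hφo 0 fun h => by linarith [h.1]
  have hφT : φ P.T = P.T := hφo P.T fun h => by linarith [h.2]
  have hφa : φ a = a := hφo a fun h => lt_irrefl _ h.1
  have hφb : φ b = b := hφo b fun h => lt_irrefl _ h.2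
  have hφI : ∀ t ∈ Ioo 0 P.T, φ t ∈ Ioo 0 P.T := fun t ht =>
    ⟨hφ0 ▸ hφm ht.1, (hφm ht.2).trans_eq hφT⟩
  have hmem : ∀ t ∈ Icc a b, φ t ∈ Icc a b := fun t ht =>
    ⟨hφa.symm.le.trans (hφm.monotone ht.1), (hφm.monotone ht.2).trans hφb.le⟩
  -- `v` vanishes where `φ` is the identity
  have hvo : ∀ t, t ∉ Icc a b → φ t = t ∧ v (φ t) = 0 := fun t ht => by
    have h1 := hφo t fun h => ht (Ioo_subset_Icc_self h)
    exact ⟨h1, by rw [h1]; exact hv₀ t fun h => ht (Ioo_subset_Icc_self h)⟩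
  have hD : ∀ t ∈ Ioo 0 P.T,
      HasDerivAt φ (Real.exp (v (φ t)) * P.σ t / P.σ (φ t)) t := fun t ht => by
    convert hφd t using 1
    by_cases h : t ∈ Icc a b
    · rw [hτσ t h, hτσ _ (hmem t h), Real.exp_neg]
      have := Real.exp_pos (v (φ t))
      have := hσ₀ _ (hφI t ht)
      field_simp
    · obtain ⟨h1, h2⟩ := hvo t h
      rw [h2, h1]
      have := hσ₀ t ht
      have := hτ₀ t
      simp only [neg_zero, Real.exp_zero, one_mul]
      rw [div_self, div_self] <;> positivity
  let y : Policy n := ⟨fun t => x.I (φ t), fun t => q (v (φ t)) (x.p (φ t)),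
    fun t => Real.exp (v (φ t) / 2) • x.ρ (φ t)⟩
  have hyS : ∀ t ∈ Ioo 0 P.T, P.sales y t = Real.exp (v (φ t)) • P.sales x (φ t) := fun t ht =>
    hS _ (hφI t ht) _
  have hyρ : ∀ t i, y.ρ t i ^ 2 = Real.exp (v (φ t)) * x.ρ (φ t) i ^ 2 := fun t i => by
    have : Real.exp (v (φ t)) = Real.exp (v (φ t) / 2) ^ 2 := by
      rw [← Real.exp_nat_mul]; congr 1; push_cast; ring
    simp only [y, Pi.smul_apply, smul_eq_mul, mul_pow, this]
  -- the profit rate of `y` is the pull-back of `k`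
  set δ : ℝ → ℝ := fun s => G (v s) * (f s * P.σ s) with hδ
  set k : ℝ → ℝ := fun s => P.profitRate x s + δ s with hk
  have hrate : ∀ t ∈ Ioo 0 P.T, P.profitRate y t =
      (k ∘ φ) t * (Real.exp (v (φ t)) * P.σ t / P.σ (φ t)) := fun t ht => by
    have h1 := hrev _ (hφI t ht) (v (φ t))
    have h2 := (hσ₀ _ (hφI t ht)).ne'
    have h3 : ∑ i, P.c i * y.ρ t i ^ 2 =
        Real.exp (v (φ t)) * ∑ i, P.c i * x.ρ (φ t) i ^ 2 := by
      rw [Finset.mul_sum]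
      exact Finset.sum_congr rfl fun i _ => by rw [hyρ]; ring
    have h4 : ∑ i, y.p t i * P.sales y t i = Real.exp (v (φ t)) *
        ∑ i, q (v (φ t)) (x.p (φ t)) i * P.sales x (φ t) i := by
      rw [Finset.mul_sum]
      refine Finset.sum_congr rfl fun i _ => ?_
      rw [hyS t ht]; simp only [y, Pi.smul_apply, smul_eq_mul]; ring
    simp only [profitRate, Function.comp, hk, hδ]
    rw [h3, h4, h1]
    field_simp
    ring
  have hδs : Function.support δ ⊆ Ioc a b := fun s hs => by
    by_contra h
    exact hs (by simp [hδ, hv₀ s fun h' => h (Ioo_subset_Ioc_self h'), hG₀])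
  have hδi : Integrable δ := by
    refine (integrableOn_iff_integrable_of_support_subset
      (hδs.trans Ioc_subset_Icc_self)).1 (ContinuousOn.integrableOn_Icc ?_)
    exact (hG.comp hv).continuousOn.mul ((hf.mono hsub).mul (hσ.mono hsub))
  have hki : IntervalIntegrable k volume 0 P.T := hx.integrable.add hδi.intervalIntegrable
  have hkint : ∫ t in (0 : ℝ)..P.T, k t = P.profit x + ∫ t in a..b, δ t := by
    rw [hk, intervalIntegral.integral_add hx.integrable hδi.intervalIntegrable, profit,
      intervalIntegral.integral_eq_integral_of_support_subset hδs,
      intervalIntegral.integral_eq_integral_of_support_subset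
        (hδs.trans (Ioc_subset_Ioc ha.le hb.le))]
  have hD' : ∀ t ∈ Ioo (min 0 P.T) (max 0 P.T),
      HasDerivAt φ (Real.exp (v (φ t)) * P.σ t / P.σ (φ t)) t := by
    rw [min_eq_left hT.le, max_eq_right hT.le]; exact hD
  have hD₀ : ∀ t ∈ Ioo (min 0 P.T) (max 0 P.T),
      0 ≤ Real.exp (v (φ t)) * P.σ t / P.σ (φ t) := by
    rw [min_eq_left hT.le, max_eq_right hT.le]
    exact fun t ht => (div_pos (mul_pos (Real.exp_pos _) (hσ₀ t ht)) (hσ₀ _ (hφI t ht))).le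
  have hφuc : ContinuousOn φ (uIcc 0 P.T) := hφc.continuousOn
  have hae : ∀ᵐ t, t ∈ uIoc 0 P.T → P.profitRate y t =
      (k ∘ φ) t * (Real.exp (v (φ t)) * P.σ t / P.σ (φ t)) := by
    have : ∀ᵐ t : ℝ, t ≠ P.T := by simp [ae_iff]
    filter_upwards [this] with t ht htT
    rw [uIoc_of_le hT.le] at htT
    exact hrate t ⟨htT.1, htT.2.lt_of_ne ht⟩
  have hyi : IntervalIntegrable (P.profitRate y) volume 0 P.T := by
    have h1 : IntervalIntegrable
        (fun t => (k ∘ φ) t * (Real.exp (v (φ t)) * P.σ t / P.σ (φ t))) volume 0 P.T := by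
      refine (intervalIntegral.integrable_comp_mul_deriv_iff_of_deriv_nonneg hφuc hD' hD₀).2 ?_
      rwa [hφ0, hφT]
    refine h1.congr_ae ?_
    rw [Filter.EventuallyEq, ae_restrict_iff' measurableSet_uIoc]
    filter_upwards [hae] with t ht h using (ht h).symm
  refine ⟨y, ⟨?_, ?_, ?_, ?_, ?_, ?_, ?_, ?_, ?_, hyi⟩, ?_, ?_⟩
  · refine hx.continuousOn_I.comp hφc.continuousOn fun t ht => ?_
    exact ⟨hφ0.symm.le.trans (hφm.monotone ht.1), (hφm.monotone ht.2).trans hφT.le⟩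
  · exact hq.comp_continuousOn ((hv.comp hφc).continuousOn.prodMk
      (hx.continuousOn_p.comp hφc.continuousOn hφI))
  · exact ContinuousOn.smul
      (Real.continuous_exp.comp ((hv.comp hφc).div_const 2)).continuousOn
      (hx.continuousOn_ρ.comp hφc.continuousOn hφI)
  · exact fun t ht => hx.I_pos _ (hφI t ht)
  · intro t ht i
    by_cases h : t ∈ Icc a b
    · exact hpos _ (hmem t h) i
    · simp only [y, (hvo t h).2, hq₀]
      exact hx.p_pos _ (hφI t ht) i
  · exact fun t ht i => mul_nonneg (Real.exp_pos _).le (hx.ρ_nonneg _ (hφI t ht) i)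
  · intro t ht
    have h1 := (hx.flow _ (hφI t ht)).scomp t (hD t ht)
    refine h1.congr_deriv ?_
    ext i
    have h2 := (hσ₀ _ (hφI t ht)).ne'
    rw [hyS t ht, hyρ]
    simp only [Pi.smul_apply, smul_eq_mul]
    field_simp
  · simp only [y, hφ0, hx.initial]
  · simp only [y, hφT, hx.final]
  · intro h t ht i
    simp [y, h _ (hφI t ht) i]
  · rw [profit, intervalIntegral.integral_congr_ae hae,
      intervalIntegral.integral_comp_mul_deriv_of_deriv_nonneg hφuc hD' hD₀, hφ0, hφT, hkint]

/-- What the two notions of optimality have in common: a competitor that replenishes only if `x`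
does is no better than `x`. -/
theorem profit_le_of_isOptimalCR_or_isOptimalMD {P : RetailProblem n} {x y : Policy n}
    (hx : P.IsOptimalCR x ∨ P.IsOptimalMD x) (hy : P.Admissible y)
    (hxy : P.NoReplenishment x → P.NoReplenishment y) : P.profit y ≤ P.profit x :=
  hx.elim (fun h => h.1.2 y hy) fun h => h.2 y hy (hxy h.1.2)

theorem admissible_of_isOptimalCR_or_isOptimalMD {P : RetailProblem n} {x : Policy n}
    (hx : P.IsOptimalCR x ∨ P.IsOptimalMD x) : P.Admissible x :=
  hx.elim (fun h => h.1.1) fun h => h.1.1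

/-- If prices can be changed so as to multiply the sales by `exp u`, at a gain in revenue
`G u * f t` with `G' 0 ≠ 0`, then `f` is constant along an optimal policy. -/
theorem exists_eq_const_of_priceResponse {P : RetailProblem n} {x : Policy n} (hT : 0 < P.T)
    (hx : P.IsOptimalCR x ∨ P.IsOptimalMD x) (hσ : IsSeasonality P.T P.σ)
    {q : ℝ → (Fin n → ℝ) → Fin n → ℝ} (hq : Continuous fun z : ℝ × (Fin n → ℝ) => q z.1 z.2)
    (hq₀ : ∀ p, q 0 p = p)
    (hS : ∀ t ∈ Ioo 0 P.T, ∀ u, P.S (x.I t) (q u (x.p t)) = Real.exp u • P.sales x t)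
    {G f : ℝ → ℝ} {d : ℝ} (hG : Continuous G) (hG₀ : G 0 = 0) (hGd : HasDerivAt G d 0)
    (hd : d ≠ 0) (hf : ContinuousOn f (Ioo 0 P.T))
    (hrev : ∀ t ∈ Ioo 0 P.T, ∀ u, ∑ i, q u (x.p t) i * P.sales x t i =
      ∑ i, x.p t i * P.sales x t i + G u * f t) :
    ∃ C, ∀ t ∈ Ioo 0 P.T, f t = C := by
  have hadm := admissible_of_isOptimalCR_or_isOptimalMD hx
  have key : ∀ a b, 0 < a → a < b → b < P.T → ∃ m, ∀ t ∈ Ioo a b, f t = m := by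
    intro a b ha hab hb
    have hsub : Icc a b ⊆ Ioo 0 P.T := fun t ht => ⟨ha.trans_le ht.1, ht.2.trans_lt hb⟩
    have hu : uIcc a b = Icc a b := uIcc_of_le hab.le
    have hσc := hσ.continuousOn.mono hsub
    refine exists_eq_const_of_variation hab (hf.mono hsub) hσc
      (fun t ht => hσ.pos t (hsub ht)) hGd hd hG₀ hG fun h hh hh₀ hhσ => ?_
    -- for small `ε`, both `1 + ε h` and the perturbed prices are positive
    have h1 : ∀ᶠ ε in 𝓝 (0 : ℝ), ∀ t ∈ Icc a b, 0 < 1 + ε * h t :=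
      isCompact_Icc.eventually_forall_of_forall_eventually fun t _ =>
        ((by fun_prop : Continuous fun z : ℝ × ℝ => 1 + z.1 * h z.2).tendsto
          (0, t)).eventually_const_lt (by simp)
    have h2 : ∀ᶠ u in 𝓝 (0 : ℝ), ∀ p ∈ x.p '' Icc a b, ∀ i, 0 < q u p i := by
      refine (isCompact_Icc.image_of_continuousOn
        (hadm.continuousOn_p.mono hsub)).eventually_forall_of_forall_eventually ?_
      rintro _ ⟨t, ht, rfl⟩
      refine eventually_all.2 fun i => ?_
      refine (((continuous_apply i).comp hq).tendsto (0, x.p t)).eventually_const_lt ?_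
      simpa [hq₀] using hadm.p_pos t (hsub ht) i
    have h3 : ∀ᶠ ε in 𝓝 (0 : ℝ), ∀ t ∈ Icc a b,
        ∀ p ∈ x.p '' Icc a b, ∀ i, 0 < q (-Real.log (1 + ε * h t)) p i := by
      refine isCompact_Icc.eventually_forall_of_forall_eventually fun t _ => ?_
      have h4 : ContinuousAt (fun z : ℝ × ℝ => -Real.log (1 + z.1 * h z.2)) (0, t) := by
        refine (ContinuousAt.log (by fun_prop) (by simp)).neg
      refine h4.tendsto.eventually
        (p := fun u => ∀ p ∈ x.p '' Icc a b, ∀ i, 0 < q u p i) ?_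
      simpa using h2
    filter_upwards [h1, h3] with ε hε hqε
    have hpos : ∀ t, 0 < 1 + ε * h t := fun t => by
      by_cases ht : t ∈ Icc a b
      · exact hε t ht
      · simp [hh₀ t fun h' => ht (Ioo_subset_Icc_self h')]
    obtain ⟨y, hy, hyρ, hyp⟩ := hadm.exists_reparametrization hσ.continuousOn hσ.pos ha hab hb
      (v := fun t => -Real.log (1 + ε * h t))
      ((Continuous.log (by fun_prop) fun t => (hpos t).ne').neg)
      (fun t ht => by simp [hh₀ t ht]) (by
        have h5 : ∀ t, Real.exp (- -Real.log (1 + ε * h t)) * P.σ t =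
            P.σ t + ε * (h t * P.σ t) := fun t => by
          rw [neg_neg, Real.exp_log (hpos t)]; ring
        simp only [h5]
        rw [intervalIntegral.integral_add, intervalIntegral.integral_const_mul, hhσ, mul_zero,
          add_zero]
        · exact (hu ▸ hσc : ContinuousOn P.σ (uIcc a b)).intervalIntegrable
        · exact ((hh.continuousOn.mul (hu ▸ hσc)).intervalIntegrable).const_mul _)
      hq hq₀ (fun t ht i => hqε t ht _ ⟨t, ht, rfl⟩ i) hS hG hG₀ hf hrev
    have := profit_le_of_isOptimalCR_or_isOptimalMD hx hy hyρ
    linarith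
  refine ⟨f (P.T / 2), fun t ht => ?_⟩
  have h2 : P.T / 2 ∈ Ioo 0 P.T := ⟨by linarith, by linarith⟩
  obtain ⟨a, ha, ha'⟩ := exists_between (lt_min ht.1 h2.1)
  obtain ⟨b, hb, hb'⟩ := exists_between (max_lt ht.2 h2.2)
  obtain ⟨m, hm⟩ := key a b ha
    ((ha'.trans_le (min_le_left _ _)).trans ((le_max_left _ _).trans_lt hb)) hb'
  rw [hm t ⟨ha'.trans_le (min_le_left _ _), (le_max_left _ _).trans_lt hb⟩,
    hm _ ⟨ha'.trans_le (min_le_right _ _), (le_max_right _ _).trans_lt hb⟩]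

/-! ### Demand independent of the price -/

/-- If demand does not respond to the price, no policy is optimal: raising the price by
`1 / (S σ)` raises the profit by the length of the season. -/
theorem not_isOptimal_of_sales_indep {P : RetailProblem 1} {x : Policy 1} (hT : 0 < P.T)
    (hσ : IsSeasonality P.T P.σ) (hS : ∀ I p p', P.S I p = P.S I p')
    (hsc : ContinuousOn (fun t => P.sales x t 0) (Ioo 0 P.T))
    (hs₀ : ∀ t ∈ Ioo 0 P.T, 0 < P.sales x t 0) : ¬ (P.IsOptimalCR x ∨ P.IsOptimalMD x) := by
  intro hx
  have hadm := admissible_of_isOptimalCR_or_isOptimalMD hx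
  have hpos : ∀ t ∈ Ioo 0 P.T, 0 < P.sales x t 0 * P.σ t := fun t ht =>
    mul_pos (hs₀ t ht) (hσ.pos t ht)
  let y : Policy 1 := ⟨x.I, fun t i => x.p t i + (P.sales x t 0 * P.σ t)⁻¹, x.ρ⟩
  have hys : ∀ t, P.sales y t = P.sales x t := fun t => hS _ _ _
  have hae : ∀ᵐ t, t ∈ uIoc 0 P.T → P.profitRate x t + 1 = P.profitRate y t := by
    have : ∀ᵐ t : ℝ, t ≠ P.T := by simp [ae_iff]
    filter_upwards [this] with t ht htT
    rw [uIoc_of_le hT.le] at htT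
    have h1 := (hpos t ⟨htT.1, htT.2.lt_of_ne ht⟩).ne'
    have h2 := left_ne_zero_of_mul h1
    have h3 := right_ne_zero_of_mul h1
    simp only [profitRate, hys, Finset.univ_unique, Fin.default_eq_zero, Finset.sum_singleton, y]
    field_simp
    ring
  have hi : IntervalIntegrable (fun t => P.profitRate x t + 1) volume 0 P.T :=
    hadm.integrable.add intervalIntegrable_const
  have hy : P.Admissible y :=
    { continuousOn_I := hadm.continuousOn_I
      continuousOn_p := by
        refine continuousOn_pi.2 fun i => ?_
        exact (continuousOn_pi.1 hadm.continuousOn_p i).add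
          ((hsc.mul hσ.continuousOn).inv₀ fun t ht => (hpos t ht).ne')
      continuousOn_ρ := hadm.continuousOn_ρ
      I_pos := hadm.I_pos
      p_pos := fun t ht i => add_pos (hadm.p_pos t ht i) (inv_pos.2 (hpos t ht))
      ρ_nonneg := hadm.ρ_nonneg
      flow := fun t ht => by rw [hys]; exact hadm.flow t ht
      initial := hadm.initial
      final := hadm.final
      integrable := hi.congr_ae <| by
        rw [Filter.EventuallyEq, ae_restrict_iff' measurableSet_uIoc]; exact hae }
  have h1 := profit_le_of_isOptimalCR_or_isOptimalMD hx hy id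
  have h2 : P.profit y = P.profit x + P.T := by
    rw [profit, ← intervalIntegral.integral_congr_ae hae,
      intervalIntegral.integral_add hadm.integrable intervalIntegrable_const]
    simp [profit]
  linarith

/-! ### The three models -/

theorem Admissible.continuousOn_inventory {P : RetailProblem n} {x : Policy n}
    (hx : P.Admissible x) (i : Fin n) : ContinuousOn (fun t => x.I t i) (Ioo 0 P.T) :=
  continuousOn_pi.1 (hx.continuousOn_I.mono Ioo_subset_Icc_self) i

theorem Admissible.continuousOn_price {P : RetailProblem n} {x : Policy n}
    (hx : P.Admissible x) (i : Fin n) : ContinuousOn (fun t => x.p t i) (Ioo 0 P.T) :=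
  continuousOn_pi.1 hx.continuousOn_p i

end RetailProblem

open RetailProblem

theorem corollary3 :
    -- (i) the exponential model for `n` items
    (∀ (n : ℕ) (S₀ : Fin n → ℝ) (α Γ : Matrix (Fin n) (Fin n) ℝ) (P : RetailProblem n)
      (x : Policy n),
      (∀ i, 0 < S₀ i) → IsUnit Γ.det → 0 < P.T → IsSeasonality P.T P.σ → (∀ i, 0 ≤ P.c i) →
      P.S = exponentialDemand S₀ α Γ →
      (P.IsOptimalCR x ∨ P.IsOptimalMD x) →
      ∃ C : ℝ, ∀ t ∈ Ioo 0 P.T, P.sales x t ⬝ᵥ (Γ⁻¹ *ᵥ 1) = C) ∧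
    -- (ii) the one-item exponential model: sales are constant
    (∀ (S₀ α γ : ℝ) (P : RetailProblem 1) (x : Policy 1),
      0 < S₀ → 0 < P.T → IsSeasonality P.T P.σ → 0 ≤ P.c 0 →
      P.S = exponentialDemandOne S₀ α γ →
      (P.IsOptimalCR x ∨ P.IsOptimalMD x) →
      ∃ C : ℝ, ∀ t ∈ Ioo 0 P.T, P.sales x t 0 = C) ∧
    -- (iii) the one-item constant elasticity model: revenue is constant
    (∀ (S₀ α γ : ℝ) (P : RetailProblem 1) (x : Policy 1),
      0 < S₀ → 0 < P.T → IsSeasonality P.T P.σ → 0 ≤ P.c 0 →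
      P.S = constantElasticityDemandOne S₀ α γ →
      (P.IsOptimalCR x ∨ P.IsOptimalMD x) →
      ∃ C : ℝ, ∀ t ∈ Ioo 0 P.T, P.revenue x t 0 = C) := by
  refine ⟨?_, ?_, ?_⟩
  · intro n S₀ α Γ P x hS₀ hΓ hT hσ hc hPS hx
    have hadm := admissible_of_isOptimalCR_or_isOptimalMD hx
    have hsc : ContinuousOn (P.sales x) (Ioo 0 P.T) := by
      refine continuousOn_pi.2 fun i => ?_
      simp only [sales, hPS, exponentialDemand, Matrix.mulVec, dotProduct]
      refine ((continuousOn_const.add ?_).add ?_).rexp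
      · exact continuousOn_finsetSum _ fun j _ => continuousOn_const.mul
          ((hadm.continuousOn_inventory j).log fun t ht => (hadm.I_pos t ht j).ne')
      · exact continuousOn_finsetSum _ fun j _ => continuousOn_const.mul
          (hadm.continuousOn_price j)
    refine exists_eq_const_of_priceResponse hT hx hσ (q := fun u p => p + u • (Γ⁻¹ *ᵥ 1))
      (by fun_prop) (by simp) (fun t ht u => ?_) (G := id) continuous_id rfl
      (hasDerivAt_id _) one_ne_zero ?_ fun t ht u => ?_
    · ext i
      have : Γ *ᵥ (Γ⁻¹ *ᵥ 1) = 1 := by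
        rw [Matrix.mulVec_mulVec, Matrix.mul_nonsing_inv _ hΓ, Matrix.one_mulVec]
      simp only [sales, hPS, exponentialDemand, Pi.smul_apply, smul_eq_mul, ← Real.exp_add,
        Matrix.mulVec_add, Matrix.mulVec_smul, this, Pi.add_apply, Pi.one_apply]
      congr 1
      ring
    · simp only [dotProduct]
      exact continuousOn_finsetSum _ fun j _ => (continuousOn_pi.1 hsc j).mul continuousOn_const
    · simp only [dotProduct, id, Finset.mul_sum, ← Finset.sum_add_distrib, Pi.add_apply,
        Pi.smul_apply, smul_eq_mul]
      exact Finset.sum_congr rfl fun i _ => by ring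
  · intro S₀ α γ P x hS₀ hT hσ hc hPS hx
    have hadm := admissible_of_isOptimalCR_or_isOptimalMD hx
    have hsc : ContinuousOn (fun t => P.sales x t 0) (Ioo 0 P.T) := by
      simp only [sales, hPS, exponentialDemandOne]
      exact (continuousOn_const.mul ((hadm.continuousOn_inventory 0).rpow_const fun t ht =>
        .inl (hadm.I_pos t ht 0).ne')).mul ((hadm.continuousOn_price 0).mul continuousOn_const).rexp
    rcases eq_or_ne γ 0 with rfl | hγ
    · refine absurd hx (not_isOptimal_of_sales_indep hT hσ (fun I p p' => ?_) hsc fun t ht => ?_)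
      · funext i; simp [hPS, exponentialDemandOne]
      · have := hadm.I_pos t ht 0
        simp only [sales, hPS, exponentialDemandOne]
        positivity
    obtain ⟨C, hC⟩ := exists_eq_const_of_priceResponse hT hx hσ (q := fun u p i => p i + u / γ)
      (by fun_prop) (by simp) (fun t ht u => by
        ext i
        fin_cases i
        simp only [sales, hPS, exponentialDemandOne, Pi.smul_apply, smul_eq_mul]
        rw [add_mul, div_mul_cancel₀ _ hγ, Real.exp_add]
        ring)
      (G := fun u => u / γ) (f := fun t => P.sales x t 0) (d := 1 / γ) (by fun_prop) (by simp)
      ((hasDerivAt_id' 0).div_const γ) (one_div_ne_zero hγ) hsc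
      (fun t ht u => by simp [add_mul])
    exact ⟨C, hC⟩
  · intro S₀ α γ P x hS₀ hT hσ hc hPS hx
    have hadm := admissible_of_isOptimalCR_or_isOptimalMD hx
    have hsc : ContinuousOn (fun t => P.sales x t 0) (Ioo 0 P.T) := by
      simp only [sales, hPS, constantElasticityDemandOne]
      exact (continuousOn_const.mul ((hadm.continuousOn_inventory 0).rpow_const fun t ht =>
        .inl (hadm.I_pos t ht 0).ne')).mul ((hadm.continuousOn_price 0).rpow_const fun t ht =>
        .inl (hadm.p_pos t ht 0).ne')
    rcases eq_or_ne γ 0 with rfl | hγ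
    · refine absurd hx (not_isOptimal_of_sales_indep hT hσ (fun I p p' => ?_) hsc fun t ht => ?_)
      · funext i; simp [hPS, constantElasticityDemandOne]
      · have := hadm.I_pos t ht 0
        simp only [sales, hPS, constantElasticityDemandOne, Real.rpow_zero]
        positivity
    have hGd : HasDerivAt (fun u : ℝ => Real.exp (u / γ) - 1) (1 / γ) 0 := by
      simpa using (((hasDerivAt_id' (0 : ℝ)).div_const γ).exp).sub_const 1
    exact exists_eq_const_of_priceResponse hT hx hσ
      (q := fun u p i => Real.exp (u / γ) * p i)
      (by fun_prop) (by simp) (fun t ht u => by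
        ext i
        fin_cases i
        simp only [sales, hPS, constantElasticityDemandOne, Pi.smul_apply, smul_eq_mul]
        rw [Real.mul_rpow (Real.exp_pos _).le (hadm.p_pos t ht 0).le, ← Real.exp_mul,
          div_mul_cancel₀ _ hγ]
        ring)
      (G := fun u => Real.exp (u / γ) - 1) (f := fun t => P.revenue x t 0) (by fun_prop) (by simp)
      hGd (one_div_ne_zero hγ) ((hadm.continuousOn_price 0).mul hsc)
      (fun t ht u => by simp [revenue]; ring)
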